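/- Let $\varrho$ be the Rudin--Shapiro substitution $0\mapsto 02,\ 1\mapsto 32,\ 2\mapsto 01,\ 3\mapsto 31$, let $u\in\{0,1,2,3\}^{\mathbb Z}$ be any of the bi-infinite fixed points of $\varrho^2$ with legal seed $u_{-1}|u_0\in\{2|0,\,2|3,\,1|0,\,1|3\}$, and let $w\in\{\pm1\}^{\mathbb Z}$ be the balanced binary Rudin--Shapiro sequence obtained from $u$ by the coding $0,2\mapsto 1$ and $1,3\mapsto -1$. For $m_1,m_2,m_3\in\mathbb Z$ put $$\eta^{(4)}(m_1,m_2,m_3)=\lim_{N\to\infty}\frac1{2N+1}\sum_{i=-N}^{N} w_i w_{i+m_1}w_{i+m_2}w_{i+m_3},\qquad \theta^{(4)}(m_1,m_2,m_3)=\lim_{N\to\infty}\frac1{2N+1}\sum_{i=-N}^{N} (-1)^i w_i w_{i+m_1}w_{i+m_2}w_{i+m_3}.$$ Then, for all $\ell\in\mathbb Z$ and all integers $m\ge 0$ and $n\ge 1$, the following limits exist and have the following values: $$\eta^{(4)}\bigl(2^{m}(2,\,2^{n}(2\ell+1),\,2^{n}(2\ell+1)+1)\bigr)=\begin{cases}0,&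 m=0,\ n=1,\\ \frac14,& m=0,\ n=2,\\ -\frac{3}{2^n},& m=0,\ n\ge 3,\\ 0,& m\ge 1,\end{cases}$$ $$\theta^{(4)}\bigl(2^{m}(2,\,2^{n}(2\ell+1),\,2^{n}(2\ell+1)+1)\bigr)=\begin{cases}0,& m\in\{0,1\},\ n=1,\\ -(-1)^m\frac14,& m\in\{0,1\},\ n=2,\\ (-1)^m\frac{3}{2^n},& m\in\{0,1\},\ n\ge 3,\\ 0,& m\ge 2,\end{cases}$$ $$\eta^{(4)}\bigl(2^{m}(2,\,2^{n}(2\ell+1)+1,\,2^{n}(2\ell+1)+2)\bigr)=\begin{cases}0,& m=0,\ n=1,\\ -\frac14,& m=0,\ n=2,\\ \frac{3}{2^n},& m=0,\ n\ge 3,\\ 0,& m\ge 1,\end{cases}$$ $$\theta^{(4)}\bigl(2^{m}(2,\,2^{n}(2\ell+1)+1,\,2^{n}(2\ell+1)+2)\bigr)=\begin{cases}0,& m\in\{0,1\},\ n=1,\\ -\frac14,& m\in\{0,1\},\ n=2,\\ \frac{3}{2^n},& m\in\{0,1\},\ n\ge 3,\\ 0,& m\ge 2.\end{cases}$$ -/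

import Mathlib

open Filter Topology

/-- The Rudin--Shapiro substitution on the alphabet `{0, 1, 2, 3}`:
`0 ↦ 02`, `1 ↦ 32`, `2 ↦ 01`, `3 ↦ 31`. `rsSubst a r` is letter number `r` of the image of `a`. -/
def rsSubst : Fin 4 → Fin 2 → Fin 4 :=
  ![![0, 2], ![3, 2], ![0, 1], ![3, 1]]

/-- The substitution acting on bi-infinite words: the image of the letter at position `i`
occupies the positions `2 * i` and `2 * i + 1`. -/
def rsSubstWord (u : ℤ → Fin 4) : ℤ → Fin 4 :=
  fun i => if i % 2 = 0 then rsSubst (u (i / 2)) 0 else rsSubst (u (i / 2)) 1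

/-- The legal seeds `2|0`, `2|3`, `1|0`, `1|3`, as pairs (letter at `-1`, letter at `0`). -/
def rsLegalSeeds : Set (Fin 4 × Fin 4) :=
  {(2, 0), (2, 3), (1, 0), (1, 3)}

/-- `u` is a bi-infinite quaternary Rudin--Shapiro sequence: a fixed point of the square of the
substitution that has grown from a legal seed. -/
def IsQuaternaryRudinShapiro (u : ℤ → Fin 4) : Prop :=
  rsSubstWord (rsSubstWord u) = u ∧ (u (-1), u 0) ∈ rsLegalSeeds

/-- The coding `0, 2 ↦ a` and `1, 3 ↦ b`, with the balanced weights `a = 1`, `b = -1`. -/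
def rsWeight : Fin 4 → ℝ :=
  ![1, -1, 1, -1]

/-- `w` is a bi-infinite binary Rudin--Shapiro sequence with balanced weights `±1`:
the coding of one of the quaternary Rudin--Shapiro sequences. -/
def IsRudinShapiro (w : ℤ → ℝ) : Prop :=
  ∃ u : ℤ → Fin 4, IsQuaternaryRudinShapiro u ∧ w = fun i => rsWeight (u i)

/-- The average over `-N ≤ i ≤ N` of `w_i w_{i + m_1} ⋯ w_{i + m_k}`. -/
noncomputable def corrAverage (w : ℤ → ℝ) {k : ℕ} (m : Fin k → ℤ) (N : ℕ) : ℝ :=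
  1 / (2 * (N : ℝ) + 1) *
    ∑ i ∈ Finset.Icc (-(N : ℤ)) (N : ℤ), w i * ∏ j, w (i + m j)

/-- The average over `-N ≤ i ≤ N` of `(-1) ^ i w_i w_{i + m_1} ⋯ w_{i + m_k}`. -/
noncomputable def signedCorrAverage (w : ℤ → ℝ) {k : ℕ} (m : Fin k → ℤ) (N : ℕ) : ℝ :=
  1 / (2 * (N : ℝ) + 1) *
    ∑ i ∈ Finset.Icc (-(N : ℤ)) (N : ℤ), (-1 : ℝ) ^ i * (w i * ∏ j, w (i + m j))

/-- The `(k + 1)`-point correlation function `η^(k+1)` of `w` exists at `(m_1, …, m_k)` and has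
the value `c` there. -/
def HasEta (w : ℤ → ℝ) {k : ℕ} (m : Fin k → ℤ) (c : ℝ) : Prop :=
  Tendsto (corrAverage w m) atTop (𝓝 c)

/-- The signed `(k + 1)`-point correlation function `θ^(k+1)` of `w` exists at `(m_1, …, m_k)` and
has the value `c` there. -/
def HasTheta (w : ℤ → ℝ) {k : ℕ} (m : Fin k → ℤ) (c : ℝ) : Prop :=
  Tendsto (signedCorrAverage w m) atTop (𝓝 c)

/-- The word that grows from the letters `a` at `-1` and `b` at `0` under the squared
substitution. -/
def rsGrow (a b : Fin 4) (i : ℤ) : Fin 4 :=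
  if i = 0 then b
  else if i = -1 then a
  else
    rsSubst (rsSubst (rsGrow a b (i / 4)) (if i % 4 < 2 then 0 else 1))
      (if i % 2 = 0 then 0 else 1)
termination_by i.natAbs
decreasing_by omega

/-- Every legal seed grows into a quaternary Rudin--Shapiro sequence. -/
theorem exists_isQuaternaryRudinShapiro {a b : Fin 4} (h : (a, b) ∈ rsLegalSeeds) :
    ∃ u : ℤ → Fin 4, IsQuaternaryRudinShapiro u ∧ u (-1) = a ∧ u 0 = b := by
  have h0 : rsGrow a b 0 = b := by rw [rsGrow]; simp
  have h1 : rsGrow a b (-1) = a := by rw [rsGrow]; simp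
  refine ⟨rsGrow a b, ⟨?_, by rw [h0, h1]; exact h⟩, h1, h0⟩
  funext i
  have key : rsSubstWord (rsSubstWord (rsGrow a b)) i =
      rsSubst (rsSubst (rsGrow a b (i / 4)) (if i % 4 < 2 then 0 else 1))
        (if i % 2 = 0 then 0 else 1) := by
    have e : i / 2 / 2 = i / 4 := by omega
    by_cases p : i % 4 < 2
    · have q : i / 2 % 2 = 0 := by omega
      by_cases r : i % 2 = 0 <;> simp [rsSubstWord, p, q, r, e]
    · have q : ¬ i / 2 % 2 = 0 := by omega
      by_cases r : i % 2 = 0 <;> simp [rsSubstWord, p, q, r, e]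
  rw [key]
  by_cases hi : i = 0
  · subst hi
    simp only [rsLegalSeeds, Set.mem_insert_iff, Set.mem_singleton_iff, Prod.mk.injEq] at h
    rcases h with ⟨-, rfl⟩ | ⟨-, rfl⟩ | ⟨-, rfl⟩ | ⟨-, rfl⟩ <;> simp [h0, rsSubst]
  by_cases hj : i = -1
  · subst hj
    simp only [rsLegalSeeds, Set.mem_insert_iff, Set.mem_singleton_iff, Prod.mk.injEq] at h
    rcases h with ⟨rfl, -⟩ | ⟨rfl, -⟩ | ⟨rfl, -⟩ | ⟨rfl, -⟩ <;> norm_num [h1, rsSubst] <;> rfl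
  · conv_rhs => rw [rsGrow]
    simp [hi, hj]

/-! ### Means of two-sided sequences -/

/-- The sum of `f i` over `-N ≤ i < N`. -/
def symSum (f : ℤ → ℝ) (N : ℕ) : ℝ :=
  ∑ k ∈ Finset.range N, (f k + f (-(k + 1)))

/-- The two-sided sequence `f` has mean `c`. -/
def HasMean (f : ℤ → ℝ) (c : ℝ) : Prop :=
  (fun N : ℕ => symSum f N - 2 * N * c) =o[atTop] (fun N : ℕ => (N : ℝ))

theorem symSum_zero (f : ℤ → ℝ) : symSum f 0 = 0 := by simp [symSum]

theorem symSum_succ (f : ℤ → ℝ) (N : ℕ) :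
    symSum f (N + 1) = symSum f N + (f N + f (-(N + 1))) := by
  simp [symSum, Finset.sum_range_succ]

theorem symSum_neg (f : ℤ → ℝ) (N : ℕ) : symSum (fun i => -f i) N = -symSum f N := by
  simp only [symSum, ← Finset.sum_neg_distrib]
  exact Finset.sum_congr rfl fun _ _ => by ring

theorem symSum_const (c : ℝ) (N : ℕ) : symSum (fun _ => c) N = 2 * N * c := by
  simp [symSum]; ring

theorem symSum_const_mul (a : ℝ) (f : ℤ → ℝ) (N : ℕ) :
    symSum (fun i => a * f i) N = a * symSum f N := by
  simp only [symSum, Finset.mul_sum]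
  exact Finset.sum_congr rfl fun _ _ => by ring

theorem symSum_two_mul (f : ℤ → ℝ) (n : ℕ) :
    symSum f (2 * n) = symSum (fun j => f (2 * j)) n + symSum (fun j => f (2 * j + 1)) n := by
  induction n with
  | zero => simp [symSum_zero]
  | succ n ih =>
    rw [show 2 * (n + 1) = 2 * n + 1 + 1 by ring, symSum_succ, symSum_succ, ih, symSum_succ,
      symSum_succ]
    push_cast
    rw [show (-(2 * (n : ℤ) + 1 + 1)) = 2 * (-(n + 1)) by ring,
      show (-(2 * (n : ℤ) + 1)) = 2 * (-(n + 1)) + 1 by ring]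
    ring

theorem symSum_add_one (f : ℤ → ℝ) (N : ℕ) :
    symSum (fun i => f (i + 1)) N = symSum f N + f N - f (-N) := by
  induction N with
  | zero => simp [symSum_zero]
  | succ n ih =>
    rw [symSum_succ, symSum_succ, ih]
    push_cast
    rw [show (-((n : ℤ) + 1) + 1) = -n by ring]
    ring

theorem sum_Icc_eq_symSum (f : ℤ → ℝ) (N : ℕ) :
    ∑ i ∈ Finset.Icc (-(N : ℤ)) (N : ℤ), f i = symSum f N + f N := by
  induction N with
  | zero => simp [symSum_zero]
  | succ n ih =>
    have : Finset.Icc (-((n + 1 : ℕ) : ℤ)) ((n + 1 : ℕ) : ℤ) =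
        insert ((n : ℤ) + 1) (insert (-((n : ℤ) + 1)) (Finset.Icc (-(n : ℤ)) (n : ℤ))) := by
      ext x
      simp only [Finset.mem_insert, Finset.mem_Icc]
      push_cast
      omega
    rw [this, Finset.sum_insert, Finset.sum_insert, ih, symSum_succ]
    · push_cast; ring
    · simp
    · simp only [Finset.mem_insert, Finset.mem_Icc]; omega

theorem abs_symSum_sub_le {f : ℤ → ℝ} (hf : ∀ i, |f i| ≤ 1) (N : ℕ) :
    |symSum f N - symSum (fun j => f (2 * j)) (N / 2)
      - symSum (fun j => f (2 * j + 1)) (N / 2)| ≤ 2 := by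
  obtain ⟨n, rfl | rfl⟩ := Nat.even_or_odd' N
  · rw [Nat.mul_div_cancel_left _ two_pos, symSum_two_mul]
    ring_nf; norm_num
  · rw [show (2 * n + 1) / 2 = n by omega, symSum_succ, symSum_two_mul]
    have h1 := abs_le.1 (hf ((2 * n : ℕ) : ℤ))
    have h2 := abs_le.1 (hf (-(((2 * n : ℕ) : ℤ) + 1)))
    rw [abs_le]
    constructor <;> linarith

theorem isLittleO_natCast_of_abs_le {r : ℕ → ℝ} (C : ℝ) (h : ∀ N, |r N| ≤ C) :
    r =o[atTop] (fun N : ℕ => (N : ℝ)) :=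
  (Asymptotics.IsBigO.of_bound C (Eventually.of_forall fun N => by
    simpa using h N) : r =O[atTop] (fun _ => (1 : ℝ))).trans_isLittleO
    ((Asymptotics.isLittleO_const_left).2 (Or.inr (by
      simpa [Function.comp_def] using tendsto_natCast_atTop_atTop (R := ℝ))))

theorem HasMean.comp_div_two {f : ℤ → ℝ} {c : ℝ} (h : HasMean f c) :
    (fun N : ℕ => symSum f (N / 2) - 2 * ((N / 2 : ℕ) : ℝ) * c) =o[atTop]
      (fun N : ℕ => (N : ℝ)) :=
  (h.comp_tendsto (Nat.tendsto_div_const_atTop two_ne_zero)).trans_isBigO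
    (Asymptotics.IsBigO.of_bound 1 (Eventually.of_forall fun N => by
      simpa using (Nat.cast_le (α := ℝ)).2 (Nat.div_le_self N 2)))

theorem HasMean.of_even_odd {f : ℤ → ℝ} {a b : ℝ} (hf : ∀ i, |f i| ≤ 1)
    (h0 : HasMean (fun j => f (2 * j)) a) (h1 : HasMean (fun j => f (2 * j + 1)) b) :
    HasMean f ((a + b) / 2) := by
  have hr : (fun N : ℕ => symSum f N - symSum (fun j => f (2 * j)) (N / 2)
      - symSum (fun j => f (2 * j + 1)) (N / 2) - ((N : ℝ) - 2 * ((N / 2 : ℕ) : ℝ)) * (a + b))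
      =o[atTop] (fun N : ℕ => (N : ℝ)) := by
    refine isLittleO_natCast_of_abs_le (2 + |a + b|) fun N => ?_
    refine (abs_sub _ _).trans (add_le_add (abs_symSum_sub_le hf N) ?_)
    rw [abs_mul]
    refine mul_le_of_le_one_left (abs_nonneg _) ?_
    have e : (N : ℝ) = 2 * ((N / 2 : ℕ) : ℝ) + ((N % 2 : ℕ) : ℝ) := by
      exact_mod_cast (Nat.div_add_mod N 2).symm
    have l : ((N % 2 : ℕ) : ℝ) ≤ 1 := by exact_mod_cast (by omega : N % 2 ≤ 1)
    rw [abs_le]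
    constructor <;> linarith [Nat.cast_nonneg (α := ℝ) (N % 2)]
  refine ((h0.comp_div_two.add h1.comp_div_two).add hr).congr_left fun N => ?_
  ring

theorem hasMean_const (c : ℝ) : HasMean (fun _ => c) c :=
  isLittleO_natCast_of_abs_le 0 fun N => by simp [symSum_const]

theorem HasMean.const_mul {f : ℤ → ℝ} {c : ℝ} (a : ℝ) (h : HasMean f c) :
    HasMean (fun i => a * f i) (a * c) := by
  refine (Asymptotics.IsLittleO.const_mul_left h a).congr_left fun N => ?_
  rw [symSum_const_mul]; ring

theorem hasMean_add_one_iff {f : ℤ → ℝ} {c : ℝ} (hf : ∀ i, |f i| ≤ 1) :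
    HasMean (fun i => f (i + 1)) c ↔ HasMean f c := by
  have hb : (fun N : ℕ => f N - f (-N)) =o[atTop] (fun N : ℕ => (N : ℝ)) :=
    isLittleO_natCast_of_abs_le 2 fun N =>
      (abs_sub _ _).trans (by linarith [hf N, hf (-N)])
  constructor
  · intro h
    refine (Asymptotics.IsLittleO.sub h hb).congr_left fun N => ?_
    rw [symSum_add_one]; ring
  · intro h
    refine (Asymptotics.IsLittleO.add h hb).congr_left fun N => ?_
    rw [symSum_add_one]; ring

theorem HasMean.add_right {f : ℤ → ℝ} {c : ℝ} (hf : ∀ i, |f i| ≤ 1) (h : HasMean f c) (k : ℤ) :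
    HasMean (fun i => f (i + k)) c := by
  induction k using Int.induction_on with
  | zero => simpa using h
  | succ k ih =>
    have := (hasMean_add_one_iff (f := fun i => f (i + k)) fun i => hf _).2 ih
    simpa only [add_assoc, add_comm (1 : ℤ)] using this
  | pred k ih =>
    refine (hasMean_add_one_iff (f := fun i => f (i + (-(k : ℤ) - 1))) fun i => hf _).1 ?_
    convert ih using 3
    ring

theorem HasMean.tendsto {f : ℤ → ℝ} {c : ℝ} (hf : ∀ i, |f i| ≤ 1) (h : HasMean f c) :
    Tendsto (fun N : ℕ => 1 / (2 * (N : ℝ) + 1) *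
      ∑ i ∈ Finset.Icc (-(N : ℤ)) (N : ℤ), f i) atTop (𝓝 c) := by
  have hb : (fun N : ℕ => f N - c) =o[atTop] (fun N : ℕ => (N : ℝ)) :=
    isLittleO_natCast_of_abs_le (1 + |c|) fun N =>
      (abs_sub _ _).trans (by linarith [hf N])
  have h2 : (fun N : ℕ => symSum f N - 2 * N * c + (f N - c)) =o[atTop]
      (fun N : ℕ => 2 * (N : ℝ) + 1) :=
    (Asymptotics.IsLittleO.add h hb).trans_isBigO
      (Asymptotics.IsBigO.of_bound 1 (Eventually.of_forall fun N => by
        have : (0 : ℝ) ≤ N := N.cast_nonneg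
        rw [Real.norm_of_nonneg this, Real.norm_of_nonneg (by positivity)]
        linarith))
  have h3 := h2.tendsto_div_nhds_zero.add_const c
  rw [zero_add] at h3
  refine h3.congr fun N => ?_
  have : (2 * (N : ℝ) + 1) ≠ 0 := by positivity
  rw [sum_Icc_eq_symSum]
  field_simp
  ring

/-! ### The recursion of the Rudin--Shapiro sequence -/

theorem negOnePow_two_mul (j : ℤ) : (-1 : ℝ) ^ (2 * j) = 1 :=
  (even_two_mul j).neg_one_zpow

theorem negOnePow_two_mul_add_one (j : ℤ) : (-1 : ℝ) ^ (2 * j + 1) = -1 :=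
  (odd_two_mul_add_one j).neg_one_zpow

theorem negOnePow_add (i j : ℤ) : (-1 : ℝ) ^ (i + j) = (-1) ^ i * (-1) ^ j :=
  zpow_add₀ (by norm_num) i j

theorem negOnePow_eq (i : ℤ) : (-1 : ℝ) ^ i = 1 ∨ (-1 : ℝ) ^ i = -1 := by
  rcases Int.even_or_odd i with h | h
  · exact Or.inl h.neg_one_zpow
  · exact Or.inr h.neg_one_zpow

theorem abs_negOnePow (i : ℤ) : |(-1 : ℝ) ^ i| = 1 := by
  rcases negOnePow_eq i with h | h <;> simp [h]

/-- `w` is the binary image of `v` under the Rudin--Shapiro recursion. -/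
structure RSImage (w v : ℤ → ℝ) : Prop where
  even : ∀ i, w (2 * i) = v i
  odd : ∀ i, w (2 * i + 1) = (-1) ^ i * v i
  sign : ∀ i, v i = 1 ∨ v i = -1

/-- `w` and `v` are `±1`-valued and each is the image of the other under the Rudin--Shapiro
recursion. -/
def RSPair (w v : ℤ → ℝ) : Prop := RSImage w v ∧ RSImage v w

theorem RSPair.symm {w v : ℤ → ℝ} (h : RSPair w v) : RSPair v w := ⟨h.2, h.1⟩

theorem rsWeight_eq (a : Fin 4) : rsWeight a = 1 ∨ rsWeight a = -1 := by
  fin_cases a <;> simp [rsWeight]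

theorem rsSubstWord_two_mul (u : ℤ → Fin 4) (i : ℤ) :
    rsSubstWord u (2 * i) = rsSubst (u i) 0 := by
  simp [rsSubstWord]

theorem rsSubstWord_two_mul_add_one (u : ℤ → Fin 4) (i : ℤ) :
    rsSubstWord u (2 * i + 1) = rsSubst (u i) 1 := by
  have h : (2 * i + 1) / 2 = i := by omega
  have h' : (2 * i + 1) % 2 = 1 := by omega
  simp [rsSubstWord, h, h']

theorem rsWeight_rsSubst_zero (a : Fin 4) : rsWeight (rsSubst a 0) = rsWeight a := by
  fin_cases a <;> simp [rsWeight, rsSubst]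

theorem rsWeight_rsSubst_rsSubst_zero (a : Fin 4) :
    rsWeight (rsSubst (rsSubst a 0) 1) = rsWeight (rsSubst a 0) := by
  fin_cases a <;> simp [rsWeight, rsSubst]

theorem rsWeight_rsSubst_rsSubst_one (a : Fin 4) :
    rsWeight (rsSubst (rsSubst a 1) 1) = -rsWeight (rsSubst a 1) := by
  fin_cases a <;> simp [rsWeight, rsSubst]

theorem rsImage_rsSubstWord (u : ℤ → Fin 4) :
    RSImage (fun i => rsWeight (rsSubstWord (rsSubstWord u) i))
      (fun i => rsWeight (rsSubstWord u i)) where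
  even i := by simp only [rsSubstWord_two_mul _ i, rsWeight_rsSubst_zero]
  odd i := by
    simp only [rsSubstWord_two_mul_add_one _ i]
    obtain ⟨j, rfl | rfl⟩ := Int.even_or_odd' i
    · rw [rsSubstWord_two_mul, rsWeight_rsSubst_rsSubst_zero, negOnePow_two_mul, one_mul]
    · rw [rsSubstWord_two_mul_add_one, rsWeight_rsSubst_rsSubst_one, negOnePow_two_mul_add_one,
        neg_one_mul]
  sign i := rsWeight_eq _

theorem IsRudinShapiro.exists_rsPair {w : ℤ → ℝ} (hw : IsRudinShapiro w) : ∃ v, RSPair w v := by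
  obtain ⟨u, ⟨hu, -⟩, rfl⟩ := hw
  refine ⟨fun i => rsWeight (rsSubstWord u i), ?_, ?_⟩
  · have := rsImage_rsSubstWord u
    rwa [hu] at this
  · have := rsImage_rsSubstWord (rsSubstWord u)
    rwa [hu] at this

/-! ### Two-point correlations with distance one -/

theorem abs_eq_one_of_sign {x : ℝ} (h : x = 1 ∨ x = -1) : |x| = 1 := by
  rcases h with h | h <;> simp [h]

theorem symSum_negOnePow (N : ℕ) : symSum (fun i => (-1 : ℝ) ^ i) N = 0 := by
  refine Finset.sum_eq_zero fun k _ => ?_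
  simp only [zpow_neg, negOnePow_add]
  rcases negOnePow_eq k with h | h <;> rw [h] <;> norm_num

theorem hasMean_negOnePow : HasMean (fun i => (-1 : ℝ) ^ i) 0 :=
  isLittleO_natCast_of_abs_le 0 fun N => by simp [symSum_negOnePow]

theorem RSPair.abs_symSum_le {w v : ℤ → ℝ} (h : RSPair w v) (N : ℕ) :
    |symSum (fun i => (-1) ^ i * (w i * w (i + 1))) N| ≤ 2 * ((Nat.log 2 N : ℝ) + 1) := by
  induction N using Nat.strong_induction_on generalizing w v with
  | _ N ih =>
    rcases Nat.eq_zero_or_pos N with rfl | hN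
    · simp [symSum_zero]
    have hb : ∀ i : ℤ, |(-1 : ℝ) ^ i * (w i * w (i + 1))| ≤ 1 := fun i => by
      simp [abs_mul, abs_eq_one_of_sign (h.2.sign _)]
    have key := abs_symSum_sub_le hb N
    have e0 : (fun j : ℤ => (-1 : ℝ) ^ (2 * j) * (w (2 * j) * w (2 * j + 1))) =
        fun j => (-1) ^ j := by
      funext j
      rw [negOnePow_two_mul, h.1.even, h.1.odd]
      rcases h.1.sign j with e | e <;> rw [e] <;> ring
    have e1 : (fun j : ℤ => (-1 : ℝ) ^ (2 * j + 1) * (w (2 * j + 1) * w (2 * j + 1 + 1))) =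
        fun j => -((-1) ^ j * (v j * v (j + 1))) := by
      funext j
      rw [negOnePow_two_mul_add_one, h.1.odd, show 2 * j + 1 + 1 = 2 * (j + 1) by ring, h.1.even]
      ring
    rw [e0, e1, symSum_negOnePow, symSum_neg, sub_zero, sub_neg_eq_add] at key
    have hv := ih (N / 2) (by omega) h.symm
    rcases Nat.lt_or_ge N 2 with h2 | h2
    · obtain rfl : N = 1 := by omega
      simpa [symSum_zero] using key
    · rw [Nat.log_of_one_lt_of_le one_lt_two h2]
      push_cast
      rw [abs_le] at *
      constructor <;> linarith

theorem isLittleO_natLog : (fun N : ℕ => (Nat.log 2 N : ℝ)) =o[atTop] (fun N : ℕ => (N : ℝ)) := by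
  have h : (fun N : ℕ => Real.log N) =o[atTop] (fun N : ℕ => (N : ℝ)) :=
    Real.isLittleO_log_id_atTop.comp_tendsto tendsto_natCast_atTop_atTop
  refine Asymptotics.IsBigO.trans_isLittleO
    (Asymptotics.IsBigO.of_bound (1 / Real.log 2) (Eventually.of_forall fun N => ?_)) h
  have h1 := Real.natLog_le_logb N 2
  have h2 : (0 : ℝ) < Real.log 2 := Real.log_pos one_lt_two
  rw [Real.norm_of_nonneg (Nat.cast_nonneg _), Real.norm_of_nonneg (Real.log_natCast_nonneg N)]
  refine h1.trans (le_of_eq ?_)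
  rw [Real.logb]
  push_cast
  ring

theorem RSPair.hasMean_signed_two {w v : ℤ → ℝ} (h : RSPair w v) :
    HasMean (fun i => (-1) ^ i * (w i * w (i + 1))) 0 := by
  have h1 : (fun N : ℕ => 2 * ((Nat.log 2 N : ℝ) + 1)) =o[atTop] (fun N : ℕ => (N : ℝ)) :=
    (isLittleO_natLog.add (isLittleO_natCast_of_abs_le 1 fun _ => by simp)).const_mul_left 2
  refine Asymptotics.IsBigO.trans_isLittleO
    (Asymptotics.IsBigO.of_bound 1 (Eventually.of_forall fun N => ?_)) h1
  rw [mul_zero, sub_zero, one_mul, Real.norm_eq_abs]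
  exact (h.abs_symSum_le N).trans (le_abs_self _)

theorem RSPair.hasMean_two {w v : ℤ → ℝ} (h : RSPair w v) :
    HasMean (fun i => w i * w (i + 1)) 0 := by
  have := HasMean.of_even_odd (f := fun i => w i * w (i + 1)) (a := 0) (b := 0)
    (fun i => by simp [abs_mul, abs_eq_one_of_sign (h.2.sign _)])
    (by
      convert hasMean_negOnePow using 2 with j
      rw [h.1.even, h.1.odd]
      rcases h.1.sign j with e | e <;> rw [e] <;> ring)
    (by
      convert h.symm.hasMean_signed_two using 2 with j
      rw [h.1.odd, show 2 * j + 1 + 1 = 2 * (j + 1) by ring, h.1.even]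
      ring)
  simpa using this

/-! ### Four-point correlations -/

/-- The four-point product `w_i w_{i + a} w_{i + b} w_{i + c}`. -/
def fourProd (w : ℤ → ℝ) (a b c i : ℤ) : ℝ :=
  w i * (w (i + a) * w (i + b) * w (i + c))

theorem abs_fourProd_le {w : ℤ → ℝ} (hw : ∀ i, w i = 1 ∨ w i = -1) (a b c i : ℤ) :
    |fourProd w a b c i| ≤ 1 := by
  simp [fourProd, abs_mul, abs_eq_one_of_sign (hw _)]

theorem hasEta_of_hasMean {w : ℤ → ℝ} (hw : ∀ i, w i = 1 ∨ w i = -1) {a b c : ℤ} {x : ℝ}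
    (h : HasMean (fourProd w a b c) x) : HasEta w ![a, b, c] x := by
  refine (h.tendsto (abs_fourProd_le hw a b c)).congr fun N => ?_
  simp [corrAverage, fourProd, Fin.prod_univ_three]

theorem hasTheta_of_hasMean {w : ℤ → ℝ} (hw : ∀ i, w i = 1 ∨ w i = -1) {a b c : ℤ} {x : ℝ}
    (h : HasMean (fun i => (-1) ^ i * fourProd w a b c i) x) : HasTheta w ![a, b, c] x := by
  refine (h.tendsto fun i => ?_).congr fun N => ?_
  · rw [abs_mul, abs_negOnePow, one_mul]
    exact abs_fourProd_le hw a b c i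
  · simp [signedCorrAverage, fourProd, Fin.prod_univ_three]

/-- The unsigned and signed means of a four-point product, from the two residue classes. -/
theorem RSPair.fourProd_means {w v : ℤ → ℝ} (h : RSPair w v) {a b c : ℤ} {x y : ℝ}
    (h0 : HasMean (fun j => fourProd w a b c (2 * j)) x)
    (h1 : HasMean (fun j => fourProd w a b c (2 * j + 1)) y) :
    HasMean (fourProd w a b c) ((x + y) / 2) ∧
      HasMean (fun i => (-1) ^ i * fourProd w a b c i) ((x - y) / 2) := by
  refine ⟨.of_even_odd (abs_fourProd_le h.2.sign a b c) h0 h1, ?_⟩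
  rw [sub_eq_add_neg]
  refine .of_even_odd (fun i => ?_) ?_ ?_
  · rw [abs_mul, abs_negOnePow, one_mul]
    exact abs_fourProd_le h.2.sign a b c i
  · simpa only [negOnePow_two_mul, one_mul] using h0
  · simpa only [negOnePow_two_mul_add_one, neg_one_mul] using h1.const_mul (-1)

theorem RSPair.fourProd_double {w v : ℤ → ℝ} (h : RSPair w v) {a b c : ℤ} {x : ℝ}
    (hv : HasMean (fourProd v a b c) x) :
    HasMean (fourProd w (2 * a) (2 * b) (2 * c)) ((x + (-1) ^ (a + b + c) * x) / 2) ∧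
      HasMean (fun i => (-1) ^ i * fourProd w (2 * a) (2 * b) (2 * c) i)
        ((x - (-1) ^ (a + b + c) * x) / 2) := by
  refine h.fourProd_means ?_ ?_
  · convert hv using 2 with j
    simp only [fourProd, ← mul_add, h.1.even]
  · convert hv.const_mul ((-1) ^ (a + b + c)) using 2 with j
    simp only [fourProd, add_right_comm _ (1 : ℤ), ← mul_add, h.1.odd, negOnePow_add]
    rcases negOnePow_eq j with e | e <;> rw [e] <;> ring

theorem RSPair.fourProd_one_odd {w v : ℤ → ℝ} (h : RSPair w v) (k : ℤ) :
    HasMean (fourProd w 1 (2 * k + 1) (2 * k + 1 + 1)) 0 ∧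
      HasMean (fun i => (-1) ^ i * fourProd w 1 (2 * k + 1) (2 * k + 1 + 1) i) 0 := by
  have := h.fourProd_means (a := 1) (b := 2 * k + 1) (c := 2 * k + 1 + 1) (x := 0) (y := 0) (by
    convert (h.symm.hasMean_two.add_right
      (fun i => by simp [abs_mul, abs_eq_one_of_sign (h.1.sign _)]) k).const_mul ((-1) ^ k)
      using 2 with j
    · rw [fourProd, show 2 * j + (2 * k + 1) = 2 * (j + k) + 1 by ring,
        show 2 * j + (2 * k + 1 + 1) = 2 * (j + k + 1) by ring, h.1.even, h.1.even, h.1.odd,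
        h.1.odd, negOnePow_add]
      rcases negOnePow_eq j with e | e <;> rcases h.1.sign j with e' | e' <;> rw [e, e'] <;> ring
    · ring) (by
    convert h.symm.hasMean_two.const_mul (-(-1) ^ k) using 2 with j
    · rw [fourProd, show 2 * j + 1 + (2 * k + 1) = 2 * (j + k + 1) by ring,
        show 2 * j + 1 + (2 * k + 1 + 1) = 2 * (j + k + 1) + 1 by ring,
        show 2 * j + 1 + 1 = 2 * (j + 1) by ring, h.1.even, h.1.even, h.1.odd,
        h.1.odd, negOnePow_add, negOnePow_add, zpow_one]
      rcases negOnePow_eq j with e | e <;> rcases h.1.sign (j + k + 1) with e' | e' <;>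
        rw [e, e'] <;> ring
    · ring)
  simpa using this

theorem RSPair.fourProd_one_even {w v : ℤ → ℝ} (h : RSPair w v) {k : ℤ} {x : ℝ}
    (hv : HasMean (fourProd v 1 k (k + 1)) x) :
    HasMean (fourProd w 1 (2 * k) (2 * k + 1)) (((-1) ^ k + (-1) ^ k * x) / 2) ∧
      HasMean (fun i => (-1) ^ i * fourProd w 1 (2 * k) (2 * k + 1) i)
        (((-1) ^ k - (-1) ^ k * x) / 2) := by
  refine h.fourProd_means ?_ ?_
  · convert hasMean_const ((-1 : ℝ) ^ k) using 2 with j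
    rw [fourProd, ← add_assoc, ← mul_add, h.1.even, h.1.even, h.1.odd, h.1.odd, negOnePow_add]
    rcases negOnePow_eq j with e | e <;> rcases h.1.sign j with e' | e' <;>
      rcases h.1.sign (j + k) with e'' | e'' <;> rw [e, e', e''] <;> ring
  · convert hv.const_mul ((-1) ^ k) using 2 with j
    rw [fourProd, fourProd, show 2 * j + 1 + 1 = 2 * (j + 1) by ring,
      show 2 * j + 1 + 2 * k = 2 * (j + k) + 1 by ring,
      show 2 * j + 1 + (2 * k + 1) = 2 * (j + (k + 1)) by ring, h.1.even, h.1.even, h.1.odd,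
      h.1.odd, negOnePow_add]
    rcases negOnePow_eq j with e | e <;> rw [e] <;> ring

theorem negOnePow_two_pow_mul {n : ℕ} (l : ℤ) (hn : n ≠ 0) :
    (-1 : ℝ) ^ ((2 : ℤ) ^ n * (2 * l + 1)) = 1 :=
  Even.neg_one_zpow (((even_two).pow_of_ne_zero hn).mul_right _)

theorem RSPair.fourProd_one {w v : ℤ → ℝ} (h : RSPair w v) (l : ℤ) (n : ℕ) :
    HasMean (fourProd w 1 (2 ^ n * (2 * l + 1)) (2 ^ n * (2 * l + 1) + 1))
      (if n = 0 then 0 else 1 - 3 / 2 ^ n) ∧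
    HasMean (fun i => (-1) ^ i *
        fourProd w 1 (2 ^ n * (2 * l + 1)) (2 ^ n * (2 * l + 1) + 1) i)
      (if n = 0 then 0 else if n = 1 then -(1 / 2) else 3 / 2 ^ n) := by
  induction n generalizing w v with
  | zero => simpa using h.fourProd_one_odd l
  | succ n ih =>
    have := h.fourProd_one_even (ih h.symm).1
    rw [← mul_assoc, ← pow_succ'] at this
    rcases Nat.eq_zero_or_pos n with rfl | hn
    · simp only [pow_zero, one_mul, negOnePow_two_mul_add_one] at this
      norm_num at this ⊢
      exact this
    · rw [negOnePow_two_pow_mul l hn.ne'] at this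
      convert this using 1
      · simp only [hn.ne', if_false, Nat.succ_ne_zero]
        rw [pow_succ]; field_simp; ring_nf
      · simp only [hn.ne', if_false, Nat.succ_ne_zero, Nat.add_eq_right]
        rw [pow_succ]; field_simp; ring_nf

theorem RSPair.fourProd_two_left {w v : ℤ → ℝ} (h : RSPair w v) {k : ℤ} {y : ℝ}
    (hv : HasMean (fun i => (-1) ^ i * fourProd v 1 k (k + 1) i) y) :
    HasMean (fourProd w 2 (2 * k) (2 * k + 1)) (-((-1) ^ k * y) / 2) ∧
      HasMean (fun i => (-1) ^ i * fourProd w 2 (2 * k) (2 * k + 1) i) ((-1) ^ k * y / 2) := by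
  have := h.fourProd_means (a := 2) (b := 2 * k) (c := 2 * k + 1) (x := 0) (y := -(-1) ^ k * y) (by
    convert h.symm.hasMean_signed_two.const_mul ((-1) ^ k) using 2 with j
    · rw [fourProd, ← add_assoc, ← mul_add, show 2 * j + 2 = 2 * (j + 1) by ring, h.1.even,
        h.1.even, h.1.even, h.1.odd, negOnePow_add]
      rcases h.1.sign (j + k) with e' | e' <;> rw [e'] <;> ring
    · ring) (by
    convert hv.const_mul (-(-1) ^ k) using 2 with j
    rw [fourProd, fourProd, show 2 * j + 1 + 2 = 2 * (j + 1) + 1 by ring,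
      show 2 * j + 1 + 2 * k = 2 * (j + k) + 1 by ring,
      show 2 * j + 1 + (2 * k + 1) = 2 * (j + (k + 1)) by ring, h.1.even, h.1.odd, h.1.odd,
      h.1.odd, negOnePow_add, negOnePow_add, zpow_one]
    rcases negOnePow_eq j with e | e <;> rw [e] <;> ring)
  simpa using this

theorem RSPair.fourProd_two_right {w v : ℤ → ℝ} (h : RSPair w v) {k : ℤ} {y : ℝ}
    (hv : HasMean (fun i => (-1) ^ i * fourProd v 1 k (k + 1) i) y) :
    HasMean (fourProd w 2 (2 * k + 1) (2 * k + 2)) ((-1) ^ k * y / 2) ∧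
      HasMean (fun i => (-1) ^ i * fourProd w 2 (2 * k + 1) (2 * k + 2) i)
        ((-1) ^ k * y / 2) := by
  have := h.fourProd_means (a := 2) (b := 2 * k + 1) (c := 2 * k + 2) (x := (-1) ^ k * y) (y := 0)
    (by
    convert hv.const_mul ((-1) ^ k) using 2 with j
    rw [fourProd, fourProd, show 2 * j + 2 = 2 * (j + 1) by ring,
      show 2 * j + (2 * k + 1) = 2 * (j + k) + 1 by ring,
      show 2 * j + (2 * k + 2) = 2 * (j + (k + 1)) by ring, h.1.even, h.1.even, h.1.even,
      h.1.odd, negOnePow_add]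
    ring) (by
    convert h.symm.hasMean_signed_two.const_mul ((-1) ^ k) using 2 with j
    · rw [fourProd, show 2 * j + 1 + 2 = 2 * (j + 1) + 1 by ring,
        show 2 * j + 1 + (2 * k + 1) = 2 * (j + k + 1) by ring,
        show 2 * j + 1 + (2 * k + 2) = 2 * (j + k + 1) + 1 by ring, h.1.even, h.1.odd, h.1.odd,
        h.1.odd, negOnePow_add, negOnePow_add, negOnePow_add, zpow_one]
      rcases negOnePow_eq j with e | e <;> rcases h.1.sign (j + k + 1) with e' | e' <;>
        rw [e, e'] <;> ring
    · ring)
  simpa using this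

/-- Dilating an odd-sum tuple by powers of two: the unsigned mean vanishes from the first
dilation on, the signed mean takes over its value once and vanishes afterwards. -/
theorem RSPair.fourProd_dilate {a b c : ℤ} {x y : ℝ} (hodd : Odd (a + b + c))
    (hx : ∀ w v, RSPair w v → HasMean (fourProd w a b c) x)
    (hy : ∀ w v, RSPair w v → HasMean (fun i => (-1) ^ i * fourProd w a b c i) y)
    {w v : ℤ → ℝ} (h : RSPair w v) (m : ℕ) :
    HasMean (fourProd w (2 ^ m * a) (2 ^ m * b) (2 ^ m * c)) (if m = 0 then x else 0) ∧
      HasMean (fun i => (-1) ^ i * fourProd w (2 ^ m * a) (2 ^ m * b) (2 ^ m * c) i)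
        (if m = 0 then y else if m = 1 then x else 0) := by
  induction m generalizing w v with
  | zero => simpa using ⟨hx w v h, hy w v h⟩
  | succ m ih =>
    have := h.fourProd_double (ih h.symm).1
    simp only [← mul_assoc, ← pow_succ', ← mul_add] at this
    rcases Nat.eq_zero_or_pos m with rfl | hm
    · simpa [hodd.neg_one_zpow] using this
    · simpa [hm.ne'] using this

theorem mainTheorem10 (w : ℤ → ℝ) (hw : IsRudinShapiro w) (l : ℤ) (m n : ℕ) (hn : 1 ≤ n) :
    HasEta w
      ![2 ^ m * 2, 2 ^ m * (2 ^ n * (2 * l + 1)), 2 ^ m * (2 ^ n * (2 * l + 1) + 1)]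
      (if m = 0 then (if n = 1 then 0 else if n = 2 then 1 / 4 else -(3 / 2 ^ n)) else 0) ∧
    HasTheta w
      ![2 ^ m * 2, 2 ^ m * (2 ^ n * (2 * l + 1)), 2 ^ m * (2 ^ n * (2 * l + 1) + 1)]
      (if m = 0 ∨ m = 1 then
        (if n = 1 then 0 else if n = 2 then -((-1) ^ m * (1 / 4)) else (-1) ^ m * (3 / 2 ^ n))
        else 0) ∧
    HasEta w
      ![2 ^ m * 2, 2 ^ m * (2 ^ n * (2 * l + 1) + 1), 2 ^ m * (2 ^ n * (2 * l + 1) + 2)]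
      (if m = 0 then (if n = 1 then 0 else if n = 2 then -(1 / 4) else 3 / 2 ^ n) else 0) ∧
    HasTheta w
      ![2 ^ m * 2, 2 ^ m * (2 ^ n * (2 * l + 1) + 1), 2 ^ m * (2 ^ n * (2 * l + 1) + 2)]
      (if m = 0 ∨ m = 1 then
        (if n = 1 then 0 else if n = 2 then -(1 / 4) else 3 / 2 ^ n)
        else 0) := by
  obtain ⟨v, h⟩ := hw.exists_rsPair
  obtain ⟨p, rfl⟩ : ∃ p, n = p + 1 := ⟨n - 1, by omega⟩
  have hM : (2 : ℤ) ^ (p + 1) * (2 * l + 1) = 2 * (2 ^ p * (2 * l + 1)) := by ring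
  have hs (b : ℝ) (hb : p = 0 → b = 0) : (-1 : ℝ) ^ ((2 : ℤ) ^ p * (2 * l + 1)) * b = b := by
    rcases Nat.eq_zero_or_pos p with rfl | hp
    · simp [hb rfl]
    · rw [negOnePow_two_pow_mul l hp.ne', one_mul]
  set b : ℝ := if p = 0 then 0 else if p = 1 then -(1 / 2) else 3 / 2 ^ p with hb
  have hl (w v : ℤ → ℝ) (h : RSPair w v) := h.fourProd_two_left (h.symm.fourProd_one l p).2
  have hr (w v : ℤ → ℝ) (h : RSPair w v) := h.fourProd_two_right (h.symm.fourProd_one l p).2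
  simp only [← hb, hs b (fun hp => by simp [hb, hp]), ← hM] at hl hr
  have L := RSPair.fourProd_dilate
    (⟨2 ^ (p + 1) * (2 * l + 1) + 1, by ring⟩) (fun w v h => (hl w v h).1)
    (fun w v h => (hl w v h).2) h m
  have R := RSPair.fourProd_dilate
    (⟨2 ^ (p + 1) * (2 * l + 1) + 2, by ring⟩) (fun w v h => (hr w v h).1)
    (fun w v h => (hr w v h).2) h m
  have hb2 : b / 2 = if p + 1 = 1 then 0 else if p + 1 = 2 then -(1 / 4) else 3 / 2 ^ (p + 1) := by
    simp only [hb, Nat.add_eq_right, Nat.reduceEqDiff]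
    split_ifs
    · norm_num
    · norm_num
    · rw [pow_succ]; field_simp
  have hb2' : -b / 2 = if p + 1 = 1 then 0 else if p + 1 = 2 then 1 / 4
      else -(3 / 2 ^ (p + 1)) := by
    rw [neg_div, hb2]; split_ifs <;> simp
  rw [hb2, hb2'] at L
  rw [hb2] at R
  refine ⟨hasEta_of_hasMean h.2.sign L.1, ?_, hasEta_of_hasMean h.2.sign R.1, ?_⟩
  · convert hasTheta_of_hasMean h.2.sign L.2 using 1
    rcases m with _ | _ | m <;> simp
  · convert hasTheta_of_hasMean h.2.sign R.2 using 1
    rcases m with _ | _ | m <;> simp
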